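/- Let $M\subset\mathbb{R}^n$ be an embedded $m$-dimensional submanifold of class $C^2$ which, with the induced Riemannian metric, is complete; let $d$ be its Riemannian distance and $B(p,\varepsilon)$ its open metric balls. For $x,y\in M$ joined by a unique minimizing geodesic $\gamma:[0,1]\to M$ of $M$, write $\exp_x^{-1}y=\gamma'(0)$. A set $U\subset M$ is convex if any two of its points are joined by a unique minimizing geodesic of $M$ and this geodesic lies in $U$. For $S\subset M$ and $x\in S$, let $N^P_S(x)$ be the set of all $v\in T_xM$ for which there are $\sigma>0$ and a convex neighbourhood $U$ of $x$ in $M$ with $\langle v,\exp_x^{-1}y\rangle\le\sigma\, d(x,y)^2$ for all $y\in U\cap S$. The set $S$ is called prox-regular in $M$ if it is closed in $M$ and for every $p\in S$ there are $\varepsilon,\sigma>0$ such that $B(p,\varepsilon)$ is convex and $$\langle v,\exp_x^{-1}y\rangle\le\sigma\, d(x,y)^2\quad\text{for all }x,y\in S\cap B(p,\varepsilon)\text{ and all }v\in N^P_S(x)\text{ with }\|v\|<\varepsilon .$$ Prox-regularity in $\mathbb{R}^n$ is the same notion for $M=\mathbb{R}^n$, where $\exp_x^{-1}y=y-x$ and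 $d(x,y)=\|x-y\|$. Suppose that $S\subset M$ is closed in $\mathbb{R}^n$ (which is automatic for $S$ closed in $M$ when $M$ is closed in $\mathbb{R}^n$). If $S$ is prox-regular in $M$, then $S$ is prox-regular in $\mathbb{R}^n$. -/

import Mathlib

open Set Filter Topology MeasureTheory

/-- `M` is an (embedded) `m`-dimensional submanifold of class `C²` of `ℝⁿ`: near each of its points
a `C²` diffeomorphism between open subsets of `ℝⁿ` straightens `M` to an `m`-dimensional
linear subspace. -/
def IsC2Submanifold {n : ℕ} (m : ℕ) (M : Set (EuclideanSpace ℝ (Fin n))) : Prop :=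
  ∀ x ∈ M, ∃ (Φ : OpenPartialHomeomorph (EuclideanSpace ℝ (Fin n)) (EuclideanSpace ℝ (Fin n)))
    (F : Submodule ℝ (EuclideanSpace ℝ (Fin n))),
    x ∈ Φ.source ∧ ContDiffOn ℝ 2 Φ Φ.source ∧ ContDiffOn ℝ 2 Φ.symm Φ.target ∧
      Module.finrank ℝ F = m ∧ ∀ y ∈ Φ.source, (y ∈ M ↔ Φ y ∈ F)

/-- The tangent space `T_x M`, spanned by the velocities at `x` of curves in `M` through `x`
(for a submanifold these velocities already form a linear subspace). -/
def tangentSpaceAt {n : ℕ} (M : Set (EuclideanSpace ℝ (Fin n))) (x : EuclideanSpace ℝ (Fin n)) :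
    Submodule ℝ (EuclideanSpace ℝ (Fin n)) :=
  Submodule.span ℝ {v | ∃ γ : ℝ → EuclideanSpace ℝ (Fin n),
    (∀ᶠ t in 𝓝 0, γ t ∈ M) ∧ γ 0 = x ∧ HasDerivAt γ v 0}

/-- The normal space to `M` at `x`. -/
noncomputable def normalSpaceAt {n : ℕ} (M : Set (EuclideanSpace ℝ (Fin n))) (x : EuclideanSpace ℝ (Fin n)) :
    Submodule ℝ (EuclideanSpace ℝ (Fin n)) :=
  (tangentSpaceAt M x)ᗮ

/-- The Riemannian distance on `M` of the induced metric: the infimum of the lengths of the `C¹`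
curves in `M` from `x` to `y` (it is `∞` if there are none). -/
noncomputable def inducedEDist {n : ℕ} (M : Set (EuclideanSpace ℝ (Fin n)))
    (x y : EuclideanSpace ℝ (Fin n)) : ENNReal :=
  ⨅ (γ : ℝ → EuclideanSpace ℝ (Fin n)) (_ : ContDiffOn ℝ 1 γ (Icc 0 1) ∧
      MapsTo γ (Icc 0 1) M ∧ γ 0 = x ∧ γ 1 = y),
    ∫⁻ t in Icc (0 : ℝ) 1, ‖derivWithin γ (Icc 0 1) t‖ₑ

/-- The Riemannian distance as a real number (meaningful whenever `x` and `y` can be joined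
in `M`). -/
noncomputable def inducedDist {n : ℕ} (M : Set (EuclideanSpace ℝ (Fin n)))
    (x y : EuclideanSpace ℝ (Fin n)) : ℝ :=
  (inducedEDist M x y).toReal

/-- The open ball `B(x, ε)` in `M` for the Riemannian distance. -/
def inducedBall {n : ℕ} (M : Set (EuclideanSpace ℝ (Fin n))) (x : EuclideanSpace ℝ (Fin n))
    (ε : ℝ) : Set (EuclideanSpace ℝ (Fin n)) :=
  {y | y ∈ M ∧ inducedEDist M x y < ENNReal.ofReal ε}

/-- `M` is complete for the Riemannian distance: Cauchy sequences in `M` converge in `M`. -/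
def IsCompleteSubmanifold {n : ℕ} (M : Set (EuclideanSpace ℝ (Fin n))) : Prop :=
  ∀ u : ℕ → EuclideanSpace ℝ (Fin n), (∀ k, u k ∈ M) →
    (∀ ε : ENNReal, 0 < ε → ∃ N : ℕ, ∀ k ≥ N, ∀ l ≥ N, inducedEDist M (u k) (u l) < ε) →
    ∃ x ∈ M, Tendsto (fun k => inducedEDist M (u k) x) atTop (𝓝 0)

/-- `γ : [0, 1] → M` is a geodesic of the induced metric. The Levi-Civita covariant derivative
of `γ'` along `γ` is the tangential part of the second derivative `γ''`, so that the geodesic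
equation says that `γ''` is normal to `M`. -/
def IsGeodesicOn {n : ℕ} (M : Set (EuclideanSpace ℝ (Fin n)))
    (γ : ℝ → EuclideanSpace ℝ (Fin n)) : Prop :=
  ContDiffOn ℝ 2 γ (Icc 0 1) ∧ MapsTo γ (Icc 0 1) M ∧
    ∀ t ∈ Icc (0 : ℝ) 1, iteratedDerivWithin 2 γ (Icc 0 1) t ∈ normalSpaceAt M (γ t)

/-- `γ : [0, 1] → M` is a minimizing geodesic of `M` from `x` to `y`: a geodesic whose length is
the Riemannian distance. -/
def IsMinimizingGeodesic {n : ℕ} (M : Set (EuclideanSpace ℝ (Fin n)))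
    (x y : EuclideanSpace ℝ (Fin n)) (γ : ℝ → EuclideanSpace ℝ (Fin n)) : Prop :=
  IsGeodesicOn M γ ∧ γ 0 = x ∧ γ 1 = y ∧
    ∫⁻ t in Icc (0 : ℝ) 1, ‖derivWithin γ (Icc 0 1) t‖ₑ = inducedEDist M x y

/-- `U ⊆ M` is (geodesically) convex: any two points of `U` are joined by exactly one minimizing
geodesic of `M`, and this geodesic stays in `U`. -/
def IsGeodesicallyConvex {n : ℕ} (M U : Set (EuclideanSpace ℝ (Fin n))) : Prop :=
  U ⊆ M ∧ ∀ x ∈ U, ∀ y ∈ U, ∃ γ, IsMinimizingGeodesic M x y γ ∧ MapsTo γ (Icc 0 1) U ∧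
    ∀ γ', IsMinimizingGeodesic M x y γ' → EqOn γ' γ (Icc 0 1)

/-- The relation `w = exp_x⁻¹ y`: the vector `w` is the initial velocity of a minimizing geodesic
`[0, 1] → M` from `x` to `y`. If `x` and `y` lie in a convex set, there is exactly one such `w`. -/
def IsExpInv {n : ℕ} (M : Set (EuclideanSpace ℝ (Fin n))) (x y w : EuclideanSpace ℝ (Fin n)) :
    Prop :=
  ∃ γ, IsMinimizingGeodesic M x y γ ∧ derivWithin γ (Icc 0 1) 0 = w

/-- The proximal normal cone `N^P_S(x) ⊆ T_x M` to `S` at `x`, for `S` as a subset of `M`. -/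
def proximalNormalCone {n : ℕ} (M S : Set (EuclideanSpace ℝ (Fin n)))
    (x : EuclideanSpace ℝ (Fin n)) : Set (EuclideanSpace ℝ (Fin n)) :=
  {v | v ∈ tangentSpaceAt M x ∧ ∃ σ : ℝ, 0 < σ ∧
    ∃ U, U ∈ 𝓝[M] x ∧ IsGeodesicallyConvex M U ∧
      ∀ y ∈ U ∩ S, ∀ w, IsExpInv M x y w → inner ℝ v w ≤ σ * inducedDist M x y ^ 2}

/-- `S` is a prox-regular subset of the Riemannian manifold `M`: it is a closed subset of `M`, and
it is prox-regular at each of its points. -/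
def IsProxRegularIn {n : ℕ} (M S : Set (EuclideanSpace ℝ (Fin n))) : Prop :=
  (∃ C, IsClosed C ∧ S = M ∩ C) ∧
    ∀ p ∈ S, ∃ ε σ : ℝ, 0 < ε ∧ 0 < σ ∧ IsGeodesicallyConvex M (inducedBall M p ε) ∧
      ∀ x ∈ S ∩ inducedBall M p ε, ∀ y ∈ S ∩ inducedBall M p ε,
        ∀ v ∈ proximalNormalCone M S x, ‖v‖ < ε →
          ∀ w, IsExpInv M x y w → inner ℝ v w ≤ σ * inducedDist M x y ^ 2

/-- The proximal normal cone to `S` at `x`, for `S` as a subset of `ℝⁿ`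
(where `exp_x⁻¹ y = y - x`). -/
def euclideanProximalNormalCone {n : ℕ} (S : Set (EuclideanSpace ℝ (Fin n)))
    (x : EuclideanSpace ℝ (Fin n)) : Set (EuclideanSpace ℝ (Fin n)) :=
  {v | ∃ σ : ℝ, 0 < σ ∧ ∃ η : ℝ, 0 < η ∧
    ∀ y ∈ Metric.ball x η ∩ S, inner ℝ v (y - x) ≤ σ * ‖y - x‖ ^ 2}

/-- `S` is a prox-regular subset of `ℝⁿ` (where all balls are convex and
`exp_x⁻¹ y = y - x`). -/
def IsProxRegular {n : ℕ} (S : Set (EuclideanSpace ℝ (Fin n))) : Prop :=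
  IsClosed S ∧
    ∀ p ∈ S, ∃ ε σ : ℝ, 0 < ε ∧ 0 < σ ∧
      ∀ x ∈ S ∩ Metric.ball p ε, ∀ y ∈ S ∩ Metric.ball p ε,
        ∀ v ∈ euclideanProximalNormalCone S x, ‖v‖ < ε →
          inner ℝ v (y - x) ≤ σ * ‖y - x‖ ^ 2

/-! Split a Euclidean proximal normal `v` at `x` into its tangential part `vT` and its normal part
`v - vT`. A `C²` submanifold leaves its tangent spaces only quadratically, so the normal part pairs
with `y - x` to `O(‖y - x‖²)` (`IsC2Submanifold.exists_local_bounds`). The tangential part is an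
intrinsic proximal normal (`starProjection_mem_proximalNormalCone`), so prox-regularity in `M`
controls its pairing with `exp_x⁻¹ y`. To return to `y - x`: the acceleration of a geodesic is
normal while its velocity is tangent, and tangent spaces vary in a Lipschitz way, so the
acceleration is at most `C` times the squared speed. Hence `y - x` and `exp_x⁻¹ y` differ by `O(d²)`
(`IsMinimizingGeodesic.inner_sub_sub_le`), and locally `d ≤ C ‖y - x‖`. -/

/-! ### Uniform estimates from straightening charts -/

section Chart

variable {n : ℕ} {M : Set (EuclideanSpace ℝ (Fin n))}

/-- The differential of a straightening map sends tangent vectors into the model subspace. -/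
theorem fderiv_mem_of_mem_tangentSpaceAt {x τ : EuclideanSpace ℝ (Fin n)}
    {Φ : EuclideanSpace ℝ (Fin n) → EuclideanSpace ℝ (Fin n)}
    {F : Submodule ℝ (EuclideanSpace ℝ (Fin n))} (hd : DifferentiableAt ℝ Φ x)
    (hF : ∀ᶠ y in 𝓝 x, y ∈ M → Φ y ∈ F) (hτ : τ ∈ tangentSpaceAt M x) :
    fderiv ℝ Φ x τ ∈ F := by
  have hle : tangentSpaceAt M x ≤ F.comap (fderiv ℝ Φ x).toLinearMap := by
    refine Submodule.span_le.2 ?_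
    rintro v ⟨γ, hγM, h0, hγ⟩
    subst h0
    have h1 : HasDerivAt (fun t => Φ (γ t)) (fderiv ℝ Φ (γ 0) v) 0 :=
      hd.hasFDerivAt.comp_hasDerivAt (0 : ℝ) hγ
    have hev : ∀ᶠ t in 𝓝 (0 : ℝ), Φ (γ t) ∈ F := by
      filter_upwards [hγM, hγ.continuousAt.eventually hF] with t h h' using h' h
    have hcl : IsClosed (F : Set (EuclideanSpace ℝ (Fin n))) := F.closed_of_finiteDimensional
    have h0 : Φ (γ 0) ∈ F := hev.self_of_nhds
    refine hcl.mem_of_tendsto (hasDerivAt_iff_tendsto_slope.1 h1) ?_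
    filter_upwards [hev.filter_mono nhdsWithin_le_nhds] with t ht
    exact F.smul_mem _ (F.sub_mem ht h0)
  exact hle hτ

/-- The differential of a local parametrization sends the model subspace into the tangent
space. -/
theorem fderiv_mem_tangentSpaceAt {c f : EuclideanSpace ℝ (Fin n)}
    {Ψ : EuclideanSpace ℝ (Fin n) → EuclideanSpace ℝ (Fin n)}
    {F : Submodule ℝ (EuclideanSpace ℝ (Fin n))} (hd : DifferentiableAt ℝ Ψ c)
    (hF : ∀ᶠ y in 𝓝 c, y ∈ F → Ψ y ∈ M) (hc : c ∈ F) (hf : f ∈ F) :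
    fderiv ℝ Ψ c f ∈ tangentSpaceAt M (Ψ c) := by
  have hl : HasDerivAt (fun t : ℝ => c + t • f) f 0 := by
    simpa using ((hasDerivAt_id (0 : ℝ)).smul_const f).const_add c
  have hl0 : c + (0 : ℝ) • f = c := by simp
  refine Submodule.subset_span ⟨fun t => Ψ (c + t • f), ?_, by simp, ?_⟩
  · have := hl.continuousAt.eventually (p := fun y => y ∈ F → Ψ y ∈ M) (by simpa only [hl0] using hF)
    filter_upwards [this] with t ht using ht (F.add_mem hc (F.smul_mem _ hf))
  · exact HasFDerivAt.comp_hasDerivAt (0 : ℝ) (by rw [hl0]; exact hd.hasFDerivAt) hl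

/-- A curve in `M` with bounded velocity bounds the Riemannian distance of its endpoints. -/
theorem inducedEDist_le_of_norm_deriv_le {x y : EuclideanSpace ℝ (Fin n)} {K : ℝ}
    {γ : ℝ → EuclideanSpace ℝ (Fin n)} (hγ : ContDiffOn ℝ 1 γ (Icc 0 1))
    (hM : MapsTo γ (Icc 0 1) M) (h0 : γ 0 = x) (h1 : γ 1 = y)
    (hK : ∀ t ∈ Icc (0 : ℝ) 1, ‖derivWithin γ (Icc 0 1) t‖ ≤ K) :
    inducedEDist M x y ≤ ENNReal.ofReal K := by
  refine (iInf₂_le γ ⟨hγ, hM, h0, h1⟩).trans ?_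
  calc ∫⁻ t in Icc (0 : ℝ) 1, ‖derivWithin γ (Icc 0 1) t‖ₑ
      ≤ ∫⁻ _ in Icc (0 : ℝ) 1, ENNReal.ofReal K := by
        refine setLIntegral_mono' measurableSet_Icc fun t ht => ?_
        rw [← ofReal_norm]
        exact ENNReal.ofReal_le_ofReal (hK t ht)
    _ = ENNReal.ofReal K := by simp

/-- Uniform local estimates on a `C²` submanifold: the tangent space is Lipschitz in the base
point, the submanifold deviates quadratically from its tangent spaces, and the Riemannian distance
is bounded by a multiple of the Euclidean one. -/
theorem IsC2Submanifold.exists_local_bounds {m : ℕ} (hM : IsC2Submanifold m M)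
    {p : EuclideanSpace ℝ (Fin n)} (hp : p ∈ M) :
    ∃ r > 0, ∃ C > 0, ∀ x ∈ M ∩ Metric.ball p r, ∀ y ∈ M ∩ Metric.ball p r,
      (∀ ν ∈ normalSpaceAt M x, ∀ τ ∈ tangentSpaceAt M y,
        inner ℝ ν τ ≤ C * ‖ν‖ * ‖τ‖ * ‖y - x‖) ∧
      (∀ ν ∈ normalSpaceAt M x, inner ℝ ν (y - x) ≤ C * ‖ν‖ * ‖y - x‖ ^ 2) ∧
      inducedEDist M x y ≤ ENNReal.ofReal (C * ‖y - x‖) := by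
  obtain ⟨Φ, F, hps, hΦ, hΨ, -, hMF⟩ := hM p hp
  have hqt : Φ p ∈ Φ.target := Φ.map_source hps
  have hΨq : ContDiffAt ℝ 2 Φ.symm (Φ p) := hΨ.contDiffAt (Φ.open_target.mem_nhds hqt)
  have hΦp : ContDiffAt ℝ 2 Φ p := hΦ.contDiffAt (Φ.open_source.mem_nhds hps)
  obtain ⟨K₁, V₁, hV₁, hL₁⟩ := (hΨq.of_le one_le_two).exists_lipschitzOnWith
  obtain ⟨K₂, V₂, hV₂, hL₂⟩ :=
    (hΨq.fderiv_right (m := 1) (by norm_num)).exists_lipschitzOnWith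
  obtain ⟨K₃, V₃, hV₃, hL₃⟩ := (hΦp.of_le one_le_two).exists_lipschitzOnWith
  obtain ⟨ρ, hρ, hball⟩ := Metric.mem_nhds_iff.1
    (inter_mem (inter_mem hV₁ hV₂) (Φ.open_target.mem_nhds hqt))
  obtain ⟨r, hr, hrball⟩ := Metric.mem_nhds_iff.1
    (inter_mem (inter_mem hV₃ (Φ.open_source.mem_nhds hps))
      ((Φ.continuousAt hps).preimage_mem_nhds (Metric.ball_mem_nhds _ hρ)))
  have hdΨ : ∀ c ∈ Metric.ball (Φ p) ρ, DifferentiableAt ℝ Φ.symm c := fun c hc =>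
    (hΨ.contDiffAt (Φ.open_target.mem_nhds (hball hc).2)).differentiableAt two_ne_zero
  have hdΦ : ∀ x ∈ Metric.ball p r, DifferentiableAt ℝ Φ x := fun x hx =>
    (hΦ.contDiffAt (Φ.open_source.mem_nhds (hrball hx).1.2)).differentiableAt two_ne_zero
  have hΨM : ∀ c ∈ Metric.ball (Φ p) ρ, c ∈ F → Φ.symm c ∈ M := fun c hc hcF => by
    rw [hMF _ (Φ.map_target (hball hc).2), Φ.right_inv (hball hc).2]
    exact hcF
  have hΨT : ∀ c ∈ Metric.ball (Φ p) ρ, c ∈ F → ∀ f ∈ F,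
      fderiv ℝ Φ.symm c f ∈ tangentSpaceAt M (Φ.symm c) := fun c hc hcF f hf =>
    fderiv_mem_tangentSpaceAt (hdΨ c hc)
      (by filter_upwards [Metric.isOpen_ball.mem_nhds hc] with y hy using hΨM y hy) hcF hf
  have hnΨ : ∀ c ∈ Metric.ball (Φ p) ρ, ‖fderiv ℝ Φ.symm c‖ ≤ K₁ := fun c hc =>
    norm_fderiv_le_of_lipschitzOn ℝ (Metric.isOpen_ball.mem_nhds hc)
      (hL₁.mono fun z hz => (hball hz).1.1)
  have hnΦ : ∀ x ∈ Metric.ball p r, ‖fderiv ℝ Φ x‖ ≤ K₃ := fun x hx =>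
    norm_fderiv_le_of_lipschitzOn ℝ (Metric.isOpen_ball.mem_nhds hx)
      (hL₃.mono fun z hz => (hrball hz).1.1)
  -- `K₂ * K₃ ^ 2` serves the two estimates on normals, `K₁ * K₃` the distance; the `1` gives strict
  -- positivity.
  refine ⟨r, hr, K₂ * K₃ ^ 2 + K₁ * K₃ + 1, by positivity, ?_⟩
  rintro x ⟨hxM, hx⟩ y ⟨hyM, hy⟩
  have hxF : Φ x ∈ F := (hMF x (hrball hx).1.2).1 hxM
  have hyF : Φ y ∈ F := (hMF y (hrball hy).1.2).1 hyM
  have hcx : Φ x ∈ Metric.ball (Φ p) ρ := (hrball hx).2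
  have hcy : Φ y ∈ Metric.ball (Φ p) ρ := (hrball hy).2
  have hxi : Φ.symm (Φ x) = x := Φ.left_inv (hrball hx).1.2
  have hyi : Φ.symm (Φ y) = y := Φ.left_inv (hrball hy).1.2
  have hxy : ‖Φ y - Φ x‖ ≤ K₃ * ‖y - x‖ := hL₃.norm_sub_le (hrball hy).1.1 (hrball hx).1.1
  have hT : ∀ f ∈ F, fderiv ℝ Φ.symm (Φ x) f ∈ tangentSpaceAt M x := fun f hf => by
    simpa only [hxi] using hΨT _ hcx hxF f hf
  have hLip : ∀ c ∈ Metric.ball (Φ p) ρ,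
      ‖fderiv ℝ Φ.symm c - fderiv ℝ Φ.symm (Φ x)‖ ≤ K₂ * ‖c - Φ x‖ := fun c hc =>
    hL₂.norm_sub_le (hball hc).1.2 (hball hcx).1.2
  have hseg : segment ℝ (Φ x) (Φ y) ⊆ Metric.ball (Φ p) ρ :=
    (convex_ball _ _).segment_subset hcx hcy
  refine ⟨fun ν hν τ hτ => ?_, fun ν hν => ?_, ?_⟩
  -- Transport `τ` to `x` through the chart: the transported vector is tangent at `x`, so `ν` sees
  -- only the change of the differential of `Φ.symm`.
  · set f := fderiv ℝ Φ y τ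
    have hfF : f ∈ F := fderiv_mem_of_mem_tangentSpaceAt (hdΦ y hy)
      (by filter_upwards [Φ.open_source.mem_nhds (hrball hy).1.2] with z hz using (hMF z hz).1) hτ
    have hτf : fderiv ℝ Φ.symm (Φ y) f = τ := by
      have h1 : HasFDerivAt (Φ.symm ∘ Φ)
          ((fderiv ℝ Φ.symm (Φ y)).comp (fderiv ℝ Φ y)) y :=
        (hdΨ _ hcy).hasFDerivAt.comp y (hdΦ y hy).hasFDerivAt
      have h2 : HasFDerivAt (Φ.symm ∘ Φ)
          (ContinuousLinearMap.id ℝ (EuclideanSpace ℝ (Fin n))) y :=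
        (hasFDerivAt_id y).congr_of_eventuallyEq (by
          filter_upwards [Φ.open_source.mem_nhds (hrball hy).1.2] with z hz using Φ.left_inv hz)
      exact DFunLike.congr_fun (h1.unique h2) τ
    have hfn : ‖f‖ ≤ K₃ * ‖τ‖ :=
      (ContinuousLinearMap.le_opNorm _ _).trans (by gcongr; exact hnΦ y hy)
    have horth : inner ℝ ν (fderiv ℝ Φ.symm (Φ x) f) = 0 :=
      (Submodule.mem_orthogonal' _ _).1 hν _ (hT f hfF)
    calc inner ℝ ν τ = inner ℝ ν ((fderiv ℝ Φ.symm (Φ y) - fderiv ℝ Φ.symm (Φ x)) f) := by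
          rw [sub_apply, inner_sub_right, horth, hτf, sub_zero]
      _ ≤ ‖ν‖ * ‖(fderiv ℝ Φ.symm (Φ y) - fderiv ℝ Φ.symm (Φ x)) f‖ := real_inner_le_norm _ _
      _ ≤ ‖ν‖ * ((K₂ * (K₃ * ‖y - x‖)) * (K₃ * ‖τ‖)) := by
          gcongr
          refine (ContinuousLinearMap.le_opNorm _ _).trans ?_
          gcongr
          exact (hLip _ hcy).trans (by gcongr)
      _ = (K₂ * K₃ ^ 2) * (‖ν‖ * ‖τ‖ * ‖y - x‖) := by ring
      _ ≤ (K₂ * K₃ ^ 2 + K₁ * K₃ + 1) * (‖ν‖ * ‖τ‖ * ‖y - x‖) := by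
          gcongr
          have : (0 : ℝ) ≤ K₁ * K₃ := by positivity
          linarith
      _ = _ := by ring
  · have htaylor : ‖Φ.symm (Φ y) - Φ.symm (Φ x) - fderiv ℝ Φ.symm (Φ x) (Φ y - Φ x)‖
        ≤ K₂ * ‖Φ y - Φ x‖ * ‖Φ y - Φ x‖ := by
      refine Convex.norm_image_sub_le_of_norm_hasFDerivWithin_le' (𝕜 := ℝ)
        (fun c hc => (hdΨ c (hseg hc)).hasFDerivAt.hasFDerivWithinAt) (fun c hc => ?_)
        (convex_segment (Φ x) (Φ y)) (left_mem_segment _ _ _) (right_mem_segment _ _ _)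
      refine (hLip c (hseg hc)).trans ?_
      gcongr
      exact norm_sub_le_of_mem_segment hc
    have horth : inner ℝ ν (fderiv ℝ Φ.symm (Φ x) (Φ y - Φ x)) = 0 :=
      (Submodule.mem_orthogonal' _ _).1 hν _ (hT _ (F.sub_mem hyF hxF))
    rw [hxi, hyi] at htaylor
    calc inner ℝ ν (y - x)
        = inner ℝ ν (y - x - fderiv ℝ Φ.symm (Φ x) (Φ y - Φ x)) := by
          rw [inner_sub_right ν (y - x), horth, sub_zero]
      _ ≤ ‖ν‖ * ‖y - x - fderiv ℝ Φ.symm (Φ x) (Φ y - Φ x)‖ := real_inner_le_norm _ _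
      _ ≤ ‖ν‖ * (K₂ * (K₃ * ‖y - x‖) * (K₃ * ‖y - x‖)) := by
          gcongr
          exact htaylor.trans (by gcongr)
      _ = (K₂ * K₃ ^ 2) * (‖ν‖ * ‖y - x‖ ^ 2) := by ring
      _ ≤ (K₂ * K₃ ^ 2 + K₁ * K₃ + 1) * (‖ν‖ * ‖y - x‖ ^ 2) := by
          gcongr
          have : (0 : ℝ) ≤ K₁ * K₃ := by positivity
          linarith
      _ = _ := by ring
  -- The competing curve is the image under `Φ.symm` of the segment from `Φ x` to `Φ y`.
  · have hl : ∀ t : ℝ, HasDerivAt (fun t : ℝ => Φ x + t • (Φ y - Φ x)) (Φ y - Φ x) t := fun t => by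
      simpa using ((hasDerivAt_id t).smul_const (Φ y - Φ x)).const_add (Φ x)
    have hmem : ∀ t ∈ Icc (0 : ℝ) 1, Φ x + t • (Φ y - Φ x) ∈ Metric.ball (Φ p) ρ := fun t ht =>
      hseg (by rw [segment_eq_image']; exact ⟨t, ht, rfl⟩)
    have hder : ∀ t ∈ Icc (0 : ℝ) 1, HasDerivAt (fun t : ℝ => Φ.symm (Φ x + t • (Φ y - Φ x)))
        (fderiv ℝ Φ.symm (Φ x + t • (Φ y - Φ x)) (Φ y - Φ x)) t := fun t ht =>
      (hdΨ _ (hmem t ht)).hasFDerivAt.comp_hasDerivAt t (hl t)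
    refine inducedEDist_le_of_norm_deriv_le (γ := fun t : ℝ => Φ.symm (Φ x + t • (Φ y - Φ x)))
      ?_ ?_ (by simp [hxi]) (by simp [hyi]) ?_
    · refine (hΨ.of_le one_le_two).comp (s := Icc (0 : ℝ) 1) ?_ fun t ht => (hball (hmem t ht)).2
      fun_prop
    · exact fun t ht => hΨM _ (hmem t ht) (F.add_mem hxF (F.smul_mem _ (F.sub_mem hyF hxF)))
    · intro t ht
      rw [(hder t ht).hasDerivWithinAt.derivWithin (uniqueDiffOn_Icc one_pos t ht)]
      calc ‖fderiv ℝ Φ.symm (Φ x + t • (Φ y - Φ x)) (Φ y - Φ x)‖ ≤ K₁ * (K₃ * ‖y - x‖) :=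
            (ContinuousLinearMap.le_opNorm _ _).trans
              (mul_le_mul (hnΨ _ (hmem t ht)) hxy (norm_nonneg _) K₁.2)
        _ = (K₁ * K₃) * ‖y - x‖ := by ring
        _ ≤ _ := by
            gcongr
            have : (0 : ℝ) ≤ K₂ * K₃ ^ 2 := by positivity
            linarith

end Chart

/-! ### Speed, acceleration and chords of geodesics -/

section Geodesic

variable {n : ℕ} {M : Set (EuclideanSpace ℝ (Fin n))} {γ : ℝ → EuclideanSpace ℝ (Fin n)}

theorem IsGeodesicOn.hasDerivAt (hγ : IsGeodesicOn M γ) {t : ℝ} (ht : t ∈ Ioo (0 : ℝ) 1) :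
    HasDerivAt γ (derivWithin γ (Icc 0 1) t) t :=
  ((hγ.1.differentiableOn two_ne_zero t (Ioo_subset_Icc_self ht)).hasDerivWithinAt).hasDerivAt
    (Icc_mem_nhds ht.1 ht.2)

theorem IsGeodesicOn.contDiffOn_derivWithin (hγ : IsGeodesicOn M γ) :
    ContDiffOn ℝ 1 (derivWithin γ (Icc 0 1)) (Icc 0 1) :=
  hγ.1.derivWithin (uniqueDiffOn_Icc one_pos) (by norm_num)

theorem IsGeodesicOn.hasDerivAt_derivWithin (hγ : IsGeodesicOn M γ) {t : ℝ}
    (ht : t ∈ Ioo (0 : ℝ) 1) :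
    HasDerivAt (derivWithin γ (Icc 0 1)) (iteratedDerivWithin 2 γ (Icc 0 1) t) t := by
  have h : iteratedDerivWithin 2 γ (Icc 0 1) t
      = derivWithin (derivWithin γ (Icc 0 1)) (Icc 0 1) t := by
    rw [iteratedDerivWithin_succ]
    exact derivWithin_congr (fun s _ => congrFun iteratedDerivWithin_one s)
      (congrFun iteratedDerivWithin_one t)
  rw [h]
  exact ((hγ.contDiffOn_derivWithin.differentiableOn one_ne_zero t
    (Ioo_subset_Icc_self ht)).hasDerivWithinAt).hasDerivAt (Icc_mem_nhds ht.1 ht.2)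

theorem IsGeodesicOn.derivWithin_mem_tangentSpaceAt (hγ : IsGeodesicOn M γ) {t : ℝ}
    (ht : t ∈ Ioo (0 : ℝ) 1) : derivWithin γ (Icc 0 1) t ∈ tangentSpaceAt M (γ t) := by
  have hd : HasDerivAt (fun s => t + s) 1 (0 : ℝ) := (hasDerivAt_id (0 : ℝ)).const_add t
  refine Submodule.subset_span ⟨fun s => γ (t + s), ?_, by simp, ?_⟩
  · have : ∀ᶠ s in 𝓝 (0 : ℝ), t + s ∈ Icc (0 : ℝ) 1 :=
      hd.continuousAt.eventually
        (by simp only [add_zero]; exact Icc_mem_nhds ht.1 ht.2)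
    filter_upwards [this] with s hs using hγ.2.1 hs
  · have h : HasDerivAt γ (derivWithin γ (Icc 0 1) t) (t + 0) := by
      simpa only [add_zero] using hγ.hasDerivAt ht
    simpa only [one_smul, Function.comp_def] using h.scomp (0 : ℝ) hd

/-- Geodesics have constant speed. -/
theorem IsGeodesicOn.norm_derivWithin_eq (hγ : IsGeodesicOn M γ) {t : ℝ}
    (ht : t ∈ Icc (0 : ℝ) 1) : ‖derivWithin γ (Icc 0 1) t‖ = ‖derivWithin γ (Icc 0 1) 0‖ := by
  have hcont : ContinuousOn (fun s => ‖derivWithin γ (Icc 0 1) s‖ ^ 2) (Icc 0 1) :=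
    hγ.contDiffOn_derivWithin.continuousOn.norm.pow 2
  have hder : ∀ s ∈ Ioo (0 : ℝ) 1,
      HasDerivAt (fun s => ‖derivWithin γ (Icc 0 1) s‖ ^ 2) 0 s := fun s hs => by
    have h := (hγ.hasDerivAt_derivWithin hs).norm_sq
    have h0 : inner ℝ (derivWithin γ (Icc 0 1) s) (iteratedDerivWithin 2 γ (Icc 0 1) s) = 0 :=
      (Submodule.mem_orthogonal _ _).1 (hγ.2.2 s (Ioo_subset_Icc_self hs)) _
        (hγ.derivWithin_mem_tangentSpaceAt hs)
    rwa [h0, mul_zero] at h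
  have hsq : ‖derivWithin γ (Icc 0 1) t‖ ^ 2 = ‖derivWithin γ (Icc 0 1) 0‖ ^ 2 := by
    rcases ht.1.eq_or_lt with rfl | h0
    · rfl
    obtain ⟨s, hs, hs'⟩ := exists_hasDerivAt_eq_slope _ (fun _ => 0) h0
      (hcont.mono (Icc_subset_Icc_right ht.2))
      fun s hs => hder s ⟨hs.1, hs.2.trans_le ht.2⟩
    rw [eq_comm, div_eq_zero_iff] at hs'
    rcases hs' with h | h <;> linarith
  exact (sq_eq_sq₀ (norm_nonneg _) (norm_nonneg _)).1 hsq

theorem IsGeodesicOn.norm_sub_le (hγ : IsGeodesicOn M γ) {s t : ℝ}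
    (hs : s ∈ Icc (0 : ℝ) 1) (ht : t ∈ Icc (0 : ℝ) 1) :
    ‖γ t - γ s‖ ≤ ‖derivWithin γ (Icc 0 1) 0‖ * ‖t - s‖ :=
  (convex_Icc (0 : ℝ) 1).norm_image_sub_le_of_norm_derivWithin_le
    (hγ.1.differentiableOn two_ne_zero) (fun _ hu => (hγ.norm_derivWithin_eq hu).le) hs ht

/-- Constant speed makes the length integral equal to the initial speed. -/
theorem IsMinimizingGeodesic.inducedEDist_eq {x y : EuclideanSpace ℝ (Fin n)}
    (hγ : IsMinimizingGeodesic M x y γ) :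
    inducedEDist M x y = ENNReal.ofReal ‖derivWithin γ (Icc 0 1) 0‖ := by
  rw [← hγ.2.2.2, setLIntegral_congr_fun measurableSet_Icc
    (g := fun _ => ENNReal.ofReal ‖derivWithin γ (Icc 0 1) 0‖) fun t ht => ?_]
  · simp
  · rw [← ofReal_norm, hγ.1.norm_derivWithin_eq ht]

theorem IsMinimizingGeodesic.inducedDist_eq {x y : EuclideanSpace ℝ (Fin n)}
    (hγ : IsMinimizingGeodesic M x y γ) :
    inducedDist M x y = ‖derivWithin γ (Icc 0 1) 0‖ := by
  rw [inducedDist, hγ.inducedEDist_eq, ENNReal.toReal_ofReal (norm_nonneg _)]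

/-- The acceleration of a geodesic is bounded by the Lipschitz constant of the tangent spaces times
the square of the speed. -/
theorem IsGeodesicOn.norm_iteratedDerivWithin_le (hγ : IsGeodesicOn M γ)
    {A : Set (EuclideanSpace ℝ (Fin n))} {C : ℝ}
    (hC : 0 ≤ C) (hA : MapsTo γ (Icc 0 1) A)
    (hL : ∀ x ∈ M ∩ A, ∀ y ∈ M ∩ A, ∀ ν ∈ normalSpaceAt M x, ∀ τ ∈ tangentSpaceAt M y,
      inner ℝ ν τ ≤ C * ‖ν‖ * ‖τ‖ * ‖y - x‖) {t : ℝ} (ht : t ∈ Ioo (0 : ℝ) 1) :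
    ‖iteratedDerivWithin 2 γ (Icc 0 1) t‖ ≤ C * ‖derivWithin γ (Icc 0 1) 0‖ ^ 2 := by
  set ν := iteratedDerivWithin 2 γ (Icc 0 1) t
  set D := ‖derivWithin γ (Icc 0 1) 0‖
  have htI := Ioo_subset_Icc_self ht
  have hνN : ν ∈ normalSpaceAt M (γ t) := hγ.2.2 t htI
  -- With `ν = γ''(t)` frozen, this function vanishes at `t` and has derivative `‖ν‖²` there, while
  -- the Lipschitz tangent spaces bound its growth by `C ‖ν‖ D² |s - t|`. Cancelling `‖ν‖` gives the
  -- claim.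
  have hder : HasDerivAt (fun s => inner ℝ ν (derivWithin γ (Icc 0 1) s)) (inner ℝ ν ν) t :=
    (innerSL ℝ ν).hasFDerivAt.comp_hasDerivAt t (hγ.hasDerivAt_derivWithin ht)
  have h0 : inner ℝ ν (derivWithin γ (Icc 0 1) t) = 0 :=
    (Submodule.mem_orthogonal' _ _).1 hνN _ (hγ.derivWithin_mem_tangentSpaceAt ht)
  have hbound := hder.le_of_lip' (C := C * ‖ν‖ * D ^ 2) (by positivity) (by
    filter_upwards [Ioo_mem_nhds ht.1 ht.2] with s hs
    have hsI := Ioo_subset_Icc_self hs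
    have hT := hγ.derivWithin_mem_tangentSpaceAt hs
    have key : ∀ μ ∈ normalSpaceAt M (γ t), inner ℝ μ (derivWithin γ (Icc 0 1) s)
        ≤ C * ‖μ‖ * D ^ 2 * ‖s - t‖ := fun μ hμ =>
      calc inner ℝ μ (derivWithin γ (Icc 0 1) s)
          ≤ C * ‖μ‖ * ‖derivWithin γ (Icc 0 1) s‖ * ‖γ s - γ t‖ :=
            hL _ ⟨hγ.2.1 htI, hA htI⟩ _ ⟨hγ.2.1 hsI, hA hsI⟩ _ hμ _ hT
        _ ≤ C * ‖μ‖ * D * (D * ‖s - t‖) := by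
            rw [hγ.norm_derivWithin_eq hsI]
            gcongr
            exact hγ.norm_sub_le htI hsI
        _ = _ := by ring
    rw [h0, sub_zero, Real.norm_eq_abs, abs_le']
    refine ⟨key ν hνN, ?_⟩
    simpa using key (-ν) (Submodule.neg_mem _ hνN))
  rw [real_inner_self_eq_norm_sq, Real.norm_of_nonneg (by positivity)] at hbound
  rcases (norm_nonneg ν).eq_or_lt with h | h
  · rw [← h]; positivity
  · refine le_of_mul_le_mul_left ?_ h
    linarith

/-- The initial velocity of a geodesic agrees with its chord up to second order. -/
theorem IsGeodesicOn.inner_sub_sub_le (hγ : IsGeodesicOn M γ) {B : ℝ} (hB : 0 ≤ B)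
    (hbound : ∀ t ∈ Ioo (0 : ℝ) 1, ‖iteratedDerivWithin 2 γ (Icc 0 1) t‖ ≤ B)
    (v : EuclideanSpace ℝ (Fin n)) :
    inner ℝ v (γ 1 - γ 0 - derivWithin γ (Icc 0 1) 0) ≤ ‖v‖ * B := by
  -- Pairing with `v` first makes the mean value theorem available as an equality; it is used once
  -- for `γ` and once for `γ'`.
  obtain ⟨t, ht, h1⟩ := exists_hasDerivAt_eq_slope (fun s => inner ℝ v (γ s))
    (fun s => inner ℝ v (derivWithin γ (Icc 0 1) s)) one_pos
    (continuousOn_const.inner hγ.1.continuousOn)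
    fun s hs => (innerSL ℝ v).hasFDerivAt.comp_hasDerivAt s (hγ.hasDerivAt hs)
  obtain ⟨s, hs, h2⟩ := exists_hasDerivAt_eq_slope
    (fun s => inner ℝ v (derivWithin γ (Icc 0 1) s))
    (fun s => inner ℝ v (iteratedDerivWithin 2 γ (Icc 0 1) s)) ht.1
    (continuousOn_const.inner
      (hγ.contDiffOn_derivWithin.continuousOn.mono (Icc_subset_Icc_right ht.2.le)))
    fun s hs => (innerSL ℝ v).hasFDerivAt.comp_hasDerivAt s
      (hγ.hasDerivAt_derivWithin ⟨hs.1, hs.2.trans ht.2⟩)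
  have hle : inner ℝ v (iteratedDerivWithin 2 γ (Icc 0 1) s) ≤ ‖v‖ * B :=
    (real_inner_le_norm _ _).trans
      (mul_le_mul_of_nonneg_left (hbound s ⟨hs.1, hs.2.trans ht.2⟩) (norm_nonneg _))
  have ht0 := ht.1
  rw [sub_zero, eq_div_iff ht.1.ne'] at h2
  rw [sub_zero, div_one] at h1
  rw [inner_sub_right, inner_sub_right, ← h1, ← h2, mul_comm]
  calc t * _ ≤ t * (‖v‖ * B) := mul_le_mul_of_nonneg_left hle ht.1.le
    _ ≤ ‖v‖ * B := mul_le_of_le_one_left (by positivity) ht.2.le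

/-- If a minimizing geodesic is short enough to stay in a region of controlled geometry, then its
initial velocity agrees with its chord up to second order. -/
theorem IsMinimizingGeodesic.inner_sub_sub_le {p x y : EuclideanSpace ℝ (Fin n)} {r C : ℝ}
    (hγ : IsMinimizingGeodesic M x y γ) (hC : 0 ≤ C)
    (hr : dist x p + inducedDist M x y < r)
    (hL : ∀ x ∈ M ∩ Metric.ball p r, ∀ y ∈ M ∩ Metric.ball p r, ∀ ν ∈ normalSpaceAt M x,
      ∀ τ ∈ tangentSpaceAt M y, inner ℝ ν τ ≤ C * ‖ν‖ * ‖τ‖ * ‖y - x‖)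
    (v : EuclideanSpace ℝ (Fin n)) :
    inner ℝ v (y - x - derivWithin γ (Icc 0 1) 0) ≤ ‖v‖ * (C * inducedDist M x y ^ 2) := by
  -- The speed is `inducedDist M x y`, so the curve never gets farther than that from `x`.
  have hA : MapsTo γ (Icc 0 1) (Metric.ball p r) := fun t ht => by
    have h := hγ.1.norm_sub_le (left_mem_Icc.2 zero_le_one) ht
    rw [hγ.2.1, ← hγ.inducedDist_eq, ← dist_eq_norm, sub_zero, Real.norm_of_nonneg ht.1] at h
    have h' : inducedDist M x y * t ≤ inducedDist M x y :=
      mul_le_of_le_one_right ENNReal.toReal_nonneg ht.2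
    have := dist_triangle (γ t) x p
    rw [Metric.mem_ball]
    linarith
  have := hγ.1.inner_sub_sub_le (B := C * inducedDist M x y ^ 2) (by positivity)
    (fun t ht => by
      rw [hγ.inducedDist_eq]
      exact hγ.1.norm_iteratedDerivWithin_le hC hA hL ht) v
  rwa [hγ.2.1, hγ.2.2.1] at this

theorem IsMinimizingGeodesic.norm_sub_le {x y : EuclideanSpace ℝ (Fin n)}
    (hγ : IsMinimizingGeodesic M x y γ) : ‖y - x‖ ≤ inducedDist M x y := by
  have := hγ.1.norm_sub_le (left_mem_Icc.2 zero_le_one) (right_mem_Icc.2 zero_le_one)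
  rwa [hγ.2.1, hγ.2.2.1, ← hγ.inducedDist_eq, sub_zero, norm_one, mul_one] at this

end Geodesic

/-! ### Comparison of proximal normals -/

section ProxRegular

variable {n m : ℕ} {M S : Set (EuclideanSpace ℝ (Fin n))}

/-- Follows from `d ≤ C ‖y - x‖` near `x`. -/
theorem IsC2Submanifold.inducedBall_mem_nhdsWithin (hM : IsC2Submanifold m M)
    {x : EuclideanSpace ℝ (Fin n)} (hx : x ∈ M) {ε : ℝ} (hε : 0 < ε) :
    inducedBall M x ε ∈ 𝓝[M] x := by
  obtain ⟨r, hr, C, hC, hb⟩ := hM.exists_local_bounds hx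
  have h1 : Metric.ball x (min r (ε / C)) ∈ 𝓝 x := Metric.ball_mem_nhds _ (by positivity)
  filter_upwards [self_mem_nhdsWithin, mem_nhdsWithin_of_mem_nhds h1] with y hyM hy
  rw [Metric.mem_ball, dist_eq_norm, lt_min_iff, lt_div_iff₀' hC] at hy
  have := (hb x ⟨hx, Metric.mem_ball_self hr⟩ y ⟨hyM, by simpa [dist_eq_norm] using hy.1⟩).2.2
  exact ⟨hyM, this.trans_lt ((ENNReal.ofReal_lt_ofReal_iff hε).2 hy.2)⟩

/-- The tangential part of a Euclidean proximal normal is a proximal normal within `M`. -/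
theorem starProjection_mem_proximalNormalCone (hM : IsC2Submanifold m M)
    {x v : EuclideanSpace ℝ (Fin n)} (hx : x ∈ M) (hSM : S ⊆ M)
    (hconv : ∃ ε > 0, IsGeodesicallyConvex M (inducedBall M x ε))
    (hv : v ∈ euclideanProximalNormalCone S x) :
    (tangentSpaceAt M x).starProjection v ∈ proximalNormalCone M S x := by
  obtain ⟨σ, hσ, η, hη, hv⟩ := hv
  obtain ⟨ε, hε, hconv⟩ := hconv
  obtain ⟨r, hr, C, hC, hb⟩ := hM.exists_local_bounds hx
  set vT := (tangentSpaceAt M x).starProjection v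
  have hN : vT - v ∈ normalSpaceAt M x := by
    rw [← neg_sub]
    exact Submodule.neg_mem _ (Submodule.sub_starProjection_mem_orthogonal v)
  set δ := min r η
  have hδ0 : 0 < δ := lt_min hr hη
  -- The first three terms come from `v`, the normal part and the chord error. The convex ball need
  -- not be small, so `‖vT‖ / δ` covers points with `D ≥ δ`, where `D ≤ D² / δ`.
  refine ⟨Submodule.starProjection_apply_mem _ v, σ + C * ‖vT - v‖ + C * ‖vT‖ + ‖vT‖ / δ,
    by positivity, _, hM.inducedBall_mem_nhdsWithin hx hε, hconv, ?_⟩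
  rintro y ⟨-, hyS⟩ w ⟨γ, hγ, rfl⟩
  have hyx := hγ.norm_sub_le
  have hD := hγ.inducedDist_eq
  set D := inducedDist M x y
  have hD0 : 0 ≤ D := (norm_nonneg _).trans hyx
  rcases lt_or_ge D δ with h | h
  · have hyr : y ∈ Metric.ball x r := by
      rw [Metric.mem_ball, dist_eq_norm]
      exact hyx.trans_lt (h.trans_le (min_le_left _ _))
    have hyη : y ∈ Metric.ball x η := by
      rw [Metric.mem_ball, dist_eq_norm]
      exact hyx.trans_lt (h.trans_le (min_le_right _ _))
    have e1 := hγ.inner_sub_sub_le hC.le (p := x) (r := r)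
      (by rw [dist_self, zero_add]; exact h.trans_le (min_le_left _ _)) (fun a ha b hb' => (hb a ha b hb').1) (-vT)
    have e2 := (hb x ⟨hx, Metric.mem_ball_self hr⟩ y ⟨hSM hyS, hyr⟩).2.1 _ hN
    have e3 := hv y ⟨hyη, hyS⟩
    rw [norm_neg, inner_neg_left, inner_sub_right] at e1
    rw [inner_sub_left] at e2
    have e4 : C * ‖vT - v‖ * ‖y - x‖ ^ 2 ≤ C * ‖vT - v‖ * D ^ 2 := by gcongr
    have e5 : σ * ‖y - x‖ ^ 2 ≤ σ * D ^ 2 := by gcongr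
    have e6 : 0 ≤ ‖vT‖ / δ * D ^ 2 := by positivity
    change -(_ - _) ≤ ‖vT‖ * (C * D ^ 2) at e1
    linarith
  · calc inner ℝ vT (derivWithin γ (Icc 0 1) 0) ≤ ‖vT‖ * D := by
          rw [hD]; exact real_inner_le_norm _ _
      _ ≤ ‖vT‖ / δ * D ^ 2 := by
          rw [div_mul_eq_mul_div, le_div_iff₀ hδ0, sq, ← mul_assoc]
          gcongr
      _ ≤ _ := by
          have : 0 ≤ σ + C * ‖vT - v‖ + C * ‖vT‖ := by positivity
          gcongr
          linarith

end ProxRegular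

theorem theorem4p3 (n m : ℕ) (M S : Set (EuclideanSpace ℝ (Fin n)))
    (hM : IsC2Submanifold m M) (hMc : IsCompleteSubmanifold M)
    (hSc : IsClosed S) (hS : IsProxRegularIn M S) :
    IsProxRegular S := by
  obtain ⟨⟨A, -, hA⟩, hreg⟩ := hS
  have hSM : S ⊆ M := hA ▸ inter_subset_left
  refine ⟨hSc, fun p hp => ?_⟩
  obtain ⟨ε, σ, hε, hσ, hconv, hprox⟩ := hreg p hp
  obtain ⟨r, hr, C, hC, hb⟩ := hM.exists_local_bounds (hSM hp)
  obtain ⟨r', hr', hball⟩ := Metric.mem_nhdsWithin_iff.1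
    (hM.inducedBall_mem_nhdsWithin (hSM hp) hε)
  -- For `x`, `y` in the `ρ`-ball, `d ≤ 2 C ρ`; the last bound thus keeps the geodesic from `x` to
  -- `y` in the `r`-ball around `p`.
  set ρ := min (min ε r') (r / (1 + 2 * C))
  have hρ : 0 < ρ := by positivity
  have hρε : ρ ≤ ε := (min_le_left _ _).trans (min_le_left _ _)
  have hρr' : ρ ≤ r' := (min_le_left _ _).trans (min_le_right _ _)
  have hρr : ρ * (1 + 2 * C) ≤ r := (le_div_iff₀ (by positivity)).1 (min_le_right _ _)
  have hρr1 : ρ ≤ r := by nlinarith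
  -- The terms are, in order: intrinsic prox-regularity, the chord error for `vT`, and the normal
  -- part of `v`.
  refine ⟨ρ, σ * C ^ 2 + ε * (C * C ^ 2) + C * ε, hρ, by positivity, ?_⟩
  rintro x ⟨hxS, hx⟩ y ⟨hyS, hy⟩ v hv hvρ
  have hxB : x ∈ inducedBall M p ε := hball ⟨Metric.ball_subset_ball hρr' hx, hSM hxS⟩
  have hyB : y ∈ inducedBall M p ε := hball ⟨Metric.ball_subset_ball hρr' hy, hSM hyS⟩
  have hxr := Metric.ball_subset_ball hρr1 hx
  have hyr := Metric.ball_subset_ball hρr1 hy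
  -- Prox-regularity at `x` itself supplies a convex ball centred at `x`.
  obtain ⟨ε', -, hε', -, hconv', -⟩ := hreg x hxS
  have hvT := starProjection_mem_proximalNormalCone hM (hSM hxS) hSM ⟨ε', hε', hconv'⟩ hv
  have hvTn : ‖(tangentSpaceAt M x).starProjection v‖ ≤ ‖v‖ :=
    Submodule.norm_starProjection_apply_le _ v
  have hN : v - (tangentSpaceAt M x).starProjection v ∈ normalSpaceAt M x :=
    Submodule.sub_starProjection_mem_orthogonal v
  have hNn : ‖v - (tangentSpaceAt M x).starProjection v‖ ≤ ‖v‖ := by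
    rw [← Submodule.starProjection_orthogonal_val]
    exact Submodule.norm_starProjection_apply_le _ v
  set vT := (tangentSpaceAt M x).starProjection v
  obtain ⟨γ, hγ, -, -⟩ := hconv.2 x hxB y hyB
  have hw := hprox x ⟨hxS, hxB⟩ y ⟨hyS, hyB⟩ vT hvT (by linarith) _ ⟨γ, hγ, rfl⟩
  obtain ⟨-, h2, h3⟩ := hb x ⟨hSM hxS, hxr⟩ y ⟨hSM hyS, hyr⟩
  have hD : inducedDist M x y ≤ C * ‖y - x‖ :=
    ENNReal.toReal_le_of_le_ofReal (by positivity) h3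
  have hD0 : 0 ≤ inducedDist M x y := ENNReal.toReal_nonneg
  rw [Metric.mem_ball] at hx hy
  have hyx : ‖y - x‖ ≤ 2 * ρ := by
    rw [← dist_eq_norm]
    linarith [dist_triangle_right y x p]
  have hg := hγ.inner_sub_sub_le hC.le (p := p) (r := r) (by nlinarith)
    (fun a ha b hb' => (hb a ha b hb').1) vT
  have h2' := h2 _ hN
  rw [inner_sub_right] at hg
  rw [inner_sub_left] at h2'
  have hD2 : inducedDist M x y ^ 2 ≤ C ^ 2 * ‖y - x‖ ^ 2 := by
    rw [← mul_pow]; gcongr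
  have e1 : σ * inducedDist M x y ^ 2 ≤ σ * (C ^ 2 * ‖y - x‖ ^ 2) := by gcongr
  have e2 : ‖vT‖ * (C * inducedDist M x y ^ 2) ≤ ε * (C * (C ^ 2 * ‖y - x‖ ^ 2)) := by
    gcongr; linarith
  have e3 : C * ‖v - vT‖ * ‖y - x‖ ^ 2 ≤ C * ε * ‖y - x‖ ^ 2 := by
    gcongr; linarith
  linarith
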